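/- A general workflow consists of finitely many modules $m_1,\dots,m_n$, of which $m_1,\dots,m_K$ ($K\ge 1$) are private and $m_{K+1},\dots,m_n$ are public. Module $m_i$ has finite sets $I_i$ of input and $O_i$ of output attributes with $I_i\cap O_i=\emptyset$, with $O_i\cap O_k=\emptyset$ for $i\ne k$, and such that the connections ($m_i\to m_k$ if $O_i\cap I_k\neq\emptyset$) form a directed acyclic graph; $A=\bigcup_i(I_i\cup O_i)$. Hiding an attribute $b\in A$ costs $c_b\ge 0$, and privatizing a public module $m_i$ costs $\mathrm{pvt}_i\ge 0$. Every private module $m_i$ has a non-empty requirement list $(I_{i1},O_{i1}),\dots,(I_{i\ell_i},O_{i\ell_i})$ with $I_{ij}\subseteq I_i$ and $O_{ij}\subseteq O_i$; let $\ell_{\max}=\max_{i\le K}\ell_i$. A solution of the secure-view problem with set constraints is a pair $(\overline V,\overline P)$ of a set $\overline V\subseteq A$ of hidden attributes and a set $\overline P$ of privatized public modules such that for every private $m_i$ there is a $j$ with $I_{ij}\cup O_{ij}\subseteq\overline V$, and every public $m_i$ with $(I_i\cup O_i)\cap\overline V\neq\emptyset$ belongs to $\overline P$. Its cost is $c(\overline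 V)+\mathrm{pvt}(\overline P)=\sum_{b\in\overline V}c_b+\sum_{m_i\in\overline P}\mathrm{pvt}_i$, to be minimized. Consider the integer program: minimize $\sum_{b\in A}c_bx_b+\sum_{i=K+1}^n\mathrm{pvt}_iw_i$ subject to \begin{align*} &\textstyle\sum_{j=1}^{\ell_i}r_{ij}\ge 1 && (1\le i\le K),\\ & x_b\ge r_{ij} && (1\le i\le K,\ 1\le j\le \ell_i,\ b\in I_{ij}\cup O_{ij}),\\ & w_i\ge x_b && (K<i\le n,\ b\in I_i\cup O_i),\\ & x_b,r_{ij},w_i\in\{0,1\}, \end{align*} and its LP relaxation, in which the last line is replaced by $x_b,r_{ij},w_i\in[0,1]$. For a feasible point $(x,r,w)$ of the relaxation let its rounding be $\overline V=\{b: x_b\ge 1/\ell_{\max}\}$ and $\overline P=\{m_i: i>K,\ (I_i\cup O_i)\cap\overline V\ne\emptyset\}$. Then: 1. The objective values of the feasible points of the integer program are exactly the costs of the solutions of the secure-view problem. 2. The LP relaxation has an optimal solution. 3. For every feasible point $(x,r,w)$ of the LP relaxation, its rounding $(\overline V,\overline P)$ is a solution of the secure-view problem, with $c(\overline V)\le \ell_{\max}\sum_{b}c_bx_b$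 and $\mathrm{pvt}(\overline P)\le\ell_{\max}\sum_{i>K}\mathrm{pvt}_iw_i$. 4. Rounding any optimal solution of the LP relaxation is an $\ell_{\max}$-approximation: $(\overline V,\overline P)$ is a solution, and its cost $c(\overline V)+\mathrm{pvt}(\overline P)$ is at most $\ell_{\max}$ times the cost of every solution. -/

import Mathlib

noncomputable section

namespace SecureView

/-- The schema of a general workflow on the attributes `A` and the modules `M`: module `i` has
input attributes `inputs i` and output attributes `outputs i`; the modules in `priv` are private
and all the others are public. Equally named outputs and inputs are the connections. -/
structure Workflow (A M : Type*) [DecidableEq A] where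
  inputs : M → Finset A
  outputs : M → Finset A
  priv : Finset M
  disjoint_inputs_outputs : ∀ i, Disjoint (inputs i) (outputs i)
  disjoint_outputs : ∀ i j, i ≠ j → Disjoint (outputs i) (outputs j)
  exists_module : ∀ b, ∃ i, b ∈ inputs i ∪ outputs i
  /-- The connections form a directed acyclic graph. -/
  acyclic : ∀ i, ¬ Relation.TransGen (fun j k => ∃ b, b ∈ outputs j ∧ b ∈ inputs k) i i

variable {A M : Type*} [DecidableEq A]

/-- The private modules. -/
abbrev Workflow.Private (W : Workflow A M) : Type _ := {i : M // i ∈ W.priv}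

/-- The public modules. -/
abbrev Workflow.Public (W : Workflow A M) : Type _ := {i : M // i ∉ W.priv}

/-- All input and output attributes of a module. -/
def Workflow.attrs (W : Workflow A M) (i : M) : Finset A := W.inputs i ∪ W.outputs i

/-- An instance of the secure-view problem with set constraints in a general workflow: each
private module has a requirement list of pairs (set of inputs, set of outputs); hiding an attribute
and privatizing a public module have non-negative costs. -/
structure Instance (A M : Type*) [DecidableEq A] extends Workflow A M where
  req : toWorkflow.Private → List (Finset A × Finset A)
  req_inputs : ∀ i, ∀ p ∈ req i, p.1 ⊆ inputs i
  req_outputs : ∀ i, ∀ p ∈ req i, p.2 ⊆ outputs i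
  cost : A → ℝ
  cost_nonneg : ∀ b, 0 ≤ cost b
  pvt : toWorkflow.Public → ℝ
  pvt_nonneg : ∀ i, 0 ≤ pvt i

namespace Instance

variable (S : Instance A M)

/-- The attributes occurring in the `j`-th pair of the requirement list of `i`. -/
def reqSet (i : S.Private) (j : Fin (S.req i).length) : Finset A :=
  ((S.req i).get j).1 ∪ ((S.req i).get j).2

/-- The maximum length of a requirement list. -/
def ellMax : ℕ := Finset.univ.sup fun i : S.Private => (S.req i).length

/-- `(H, P)` is a solution, where `H` is the set of hidden attributes and `P` the set of privatized
public modules: some pair in the list of each private module is hidden entirely, and every public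
module with a hidden attribute is privatized. -/
structure IsSolution (H : Finset A) (P : Finset S.Public) : Prop where
  private_req : ∀ i : S.Private, ∃ p ∈ S.req i, p.1 ∪ p.2 ⊆ H
  public_privatized : ∀ i : S.Public, (∃ b ∈ S.attrs i, b ∈ H) → i ∈ P

/-- The cost of the hidden attributes. -/
def hidingCost (H : Finset A) : ℝ := ∑ b ∈ H, S.cost b

/-- The cost of the privatized modules. -/
def privatizationCost (P : Finset S.Public) : ℝ := ∑ i ∈ P, S.pvt i

/-- The combined cost of a pair `(H, P)`. -/
def totalCost (H : Finset A) (P : Finset S.Public) : ℝ :=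
  S.hidingCost H + S.privatizationCost P

/-- `(H, P)` is a solution whose cost is within the factor `μ` of the optimum. -/
def IsApproxSolution (μ : ℝ) (H : Finset A) (P : Finset S.Public) : Prop :=
  S.IsSolution H P ∧ ∀ H' P', S.IsSolution H' P' → S.totalCost H P ≤ μ * S.totalCost H' P'

/-- An assignment of real values to the variables `x_b`, `r_ij`, `w_i`. -/
structure Assignment where
  x : A → ℝ
  r : (i : S.Private) → Fin (S.req i).length → ℝ
  w : S.Public → ℝ

variable {S}

/-- The linear constraints shared by the integer program and its relaxation. -/
structure Assignment.SatisfiesConstraints (z : S.Assignment) : Prop where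
  sum_r : ∀ i, 1 ≤ ∑ j, z.r i j
  r_le_x : ∀ i j, ∀ b ∈ S.reqSet i j, z.r i j ≤ z.x b
  x_le_w : ∀ i : S.Public, ∀ b ∈ S.attrs i, z.x b ≤ z.w i

/-- Feasibility for the integer program. -/
structure Assignment.IPFeasible (z : S.Assignment) : Prop extends z.SatisfiesConstraints where
  x_mem : ∀ b, z.x b ∈ ({0, 1} : Set ℝ)
  r_mem : ∀ i j, z.r i j ∈ ({0, 1} : Set ℝ)
  w_mem : ∀ i, z.w i ∈ ({0, 1} : Set ℝ)

/-- Feasibility for the LP relaxation. -/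
structure Assignment.LPFeasible (z : S.Assignment) : Prop extends z.SatisfiesConstraints where
  x_mem : ∀ b, z.x b ∈ Set.Icc (0 : ℝ) 1
  r_mem : ∀ i j, z.r i j ∈ Set.Icc (0 : ℝ) 1
  w_mem : ∀ i, z.w i ∈ Set.Icc (0 : ℝ) 1

/-- The part of the objective that pays for attributes. -/
def Assignment.hidingObjective [Fintype A] (z : S.Assignment) : ℝ := ∑ b, S.cost b * z.x b

/-- The part of the objective that pays for public modules. -/
def Assignment.privatizationObjective [Fintype M] [DecidableEq M] (z : S.Assignment) : ℝ :=
  ∑ i, S.pvt i * z.w i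

/-- The objective of both programs. -/
def Assignment.objective [Fintype A] [Fintype M] [DecidableEq M] (z : S.Assignment) : ℝ :=
  z.hidingObjective + z.privatizationObjective

/-- `z` is an optimal solution of the LP relaxation. -/
def Assignment.LPOptimal [Fintype A] [Fintype M] [DecidableEq M] (z : S.Assignment) : Prop :=
  z.LPFeasible ∧ ∀ z' : S.Assignment, z'.LPFeasible → z.objective ≤ z'.objective

/-- The attributes hidden by the rounding: those with `x_b ≥ 1 / ℓ_max`. -/
def Assignment.roundHidden [Fintype A] (z : S.Assignment) : Finset A :=
  open Classical in Finset.univ.filter fun b => 1 / (S.ellMax : ℝ) ≤ z.x b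

/-- The public modules privatized by the rounding: those with a hidden input or output. -/
def Assignment.roundPrivatized [Fintype A] [Fintype M] [DecidableEq M] (z : S.Assignment) :
    Finset S.Public :=
  Finset.univ.filter fun i => ∃ b ∈ S.attrs i, b ∈ z.roundHidden

end Instance

end SecureView

end

namespace SecureView.Instance

variable {A M : Type*} [DecidableEq A]

section Basic

variable (S : Instance A M)

/-! At a feasible LP point the `r i j` of a private module sum to at least 1 over at most `ellMax`
indices, so one of them is at least `1 / ellMax`, and `r ≤ x` lifts its whole pair over the rounding
threshold. Conversely, a hidden attribute has `1 ≤ ellMax * x b`, and `x ≤ w` passes this bound to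
every privatized module, so each cost paid is at most `ellMax` times its LP term. Solutions encode
as 0-1 points of the same cost, which are LP feasible; hence the LP optimum is a lower bound for
every solution. It is attained by compactness. -/

theorem length_le_ellMax (i : S.Private) : (S.req i).length ≤ S.ellMax :=
  Finset.le_sup (f := fun i : S.Private => (S.req i).length) (Finset.mem_univ i)

theorem ellMax_pos (hpriv : S.priv.Nonempty) (hreq : ∀ i, S.req i ≠ []) : 0 < S.ellMax := by
  obtain ⟨i, hi⟩ := hpriv
  exact (List.length_pos_of_ne_nil (hreq ⟨i, hi⟩)).trans_le (S.length_le_ellMax ⟨i, hi⟩)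

theorem exists_reqSet_subset_iff (i : S.Private) (H : Finset A) :
    (∃ p ∈ S.req i, p.1 ∪ p.2 ⊆ H) ↔ ∃ j, S.reqSet i j ⊆ H := by
  constructor
  · rintro ⟨p, hp, hH⟩
    obtain ⟨j, rfl⟩ := List.get_of_mem hp
    exact ⟨j, hH⟩
  · rintro ⟨j, hj⟩
    exact ⟨_, List.get_mem _ j, hj⟩

open Classical in
/-- The 0-1 assignment that describes a pair `(H, P)`. -/
noncomputable def indicatorAssignment (H : Finset A) (P : Finset S.Public) : S.Assignment where
  x b := if b ∈ H then 1 else 0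
  r i j := if S.reqSet i j ⊆ H then 1 else 0
  w i := if i ∈ P then 1 else 0

variable {S}

/-- No pair has to be chosen per module: `r` is 1 at every fully hidden pair, and `sum_r` is only a
lower bound. -/
theorem IsSolution.ipFeasible {H : Finset A} {P : Finset S.Public} (h : S.IsSolution H P) :
    (S.indicatorAssignment H P).IPFeasible where
  sum_r i := by
    obtain ⟨j, hj⟩ := (S.exists_reqSet_subset_iff i H).1 (h.private_req i)
    have hle := Finset.single_le_sum (f := (S.indicatorAssignment H P).r i)
      (fun k _ => by simp only [indicatorAssignment]; split_ifs <;> norm_num) (Finset.mem_univ j)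
    simpa [indicatorAssignment, hj] using hle
  r_le_x i j b hb := by
    simp only [indicatorAssignment]
    by_cases hj : S.reqSet i j ⊆ H
    · simp [hj, hj hb]
    · rw [if_neg hj]
      split_ifs <;> norm_num
  x_le_w i b hb := by
    simp only [indicatorAssignment]
    by_cases hH : b ∈ H
    · simp [hH, h.public_privatized i ⟨b, hb, hH⟩]
    · rw [if_neg hH]
      split_ifs <;> norm_num
  x_mem b := by simp only [indicatorAssignment]; split_ifs <;> simp
  r_mem i j := by simp only [indicatorAssignment]; split_ifs <;> simp
  w_mem i := by simp only [indicatorAssignment]; split_ifs <;> simp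

theorem Assignment.IPFeasible.lpFeasible {z : S.Assignment} (hz : z.IPFeasible) :
    z.LPFeasible where
  toSatisfiesConstraints := hz.toSatisfiesConstraints
  x_mem b := by rcases hz.x_mem b with h | h <;> simp_all
  r_mem i j := by rcases hz.r_mem i j with h | h <;> simp_all
  w_mem i := by rcases hz.w_mem i with h | h <;> simp_all

/-- All attributes hidden and all public modules privatized. -/
theorem isSolution_univ [Fintype A] [Fintype M] [DecidableEq M] (hreq : ∀ i, S.req i ≠ []) :
    S.IsSolution Finset.univ Finset.univ where
  private_req i := by
    obtain ⟨p, hp⟩ := List.exists_mem_of_ne_nil _ (hreq i)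
    exact ⟨p, hp, Finset.subset_univ _⟩
  public_privatized i _ := Finset.mem_univ i

end Basic

variable [Fintype A] {S : Instance A M}

theorem Assignment.LPFeasible.exists_reqSet_subset_roundHidden {z : S.Assignment}
    (hz : z.LPFeasible) (i : S.Private) : ∃ j, S.reqSet i j ⊆ z.roundHidden := by
  have hsum := hz.sum_r i
  -- Feasibility itself excludes an empty list, whose sum would be 0.
  have hpos : 0 < (S.req i).length := by
    rcases Nat.eq_zero_or_pos (S.req i).length with h | h
    · have : IsEmpty (Fin (S.req i).length) := by rw [h]; infer_instance
      rw [Finset.univ_eq_empty, Finset.sum_empty] at hsum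
      norm_num at hsum
    · exact h
  have hpos' : (0 : ℝ) < (S.req i).length := by exact_mod_cast hpos
  have : Nonempty (Fin (S.req i).length) := ⟨⟨0, hpos⟩⟩
  -- Averaging: compare `z.r i` with the constant `1 / ℓ_i`, whose sum is 1.
  obtain ⟨j, -, hj⟩ := Finset.exists_le_of_sum_le (s := Finset.univ)
    (f := fun _ : Fin (S.req i).length => 1 / ((S.req i).length : ℝ)) (g := z.r i)
    Finset.univ_nonempty (by simpa [hpos'.ne'] using hsum)
  refine ⟨j, fun b hb => ?_⟩
  have hle : 1 / (S.ellMax : ℝ) ≤ 1 / ((S.req i).length : ℝ) :=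
    one_div_le_one_div_of_le hpos' (by exact_mod_cast S.length_le_ellMax i)
  simpa [roundHidden] using hle.trans (hj.trans (hz.r_le_x i j b hb))

/-- Positivity matters: since `1 / 0 = 0`, the threshold would otherwise degenerate to 0. -/
theorem Assignment.one_le_ellMax_mul_x {z : S.Assignment} (hpos : 0 < S.ellMax) {b : A}
    (hb : b ∈ z.roundHidden) : 1 ≤ S.ellMax * z.x b := by
  have hb' : 1 / (S.ellMax : ℝ) ≤ z.x b := by simpa [roundHidden] using hb
  have hpos' : (0 : ℝ) < S.ellMax := by exact_mod_cast hpos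
  rwa [div_le_iff₀' hpos'] at hb'

theorem Assignment.LPFeasible.hidingCost_roundHidden_le {z : S.Assignment} (hz : z.LPFeasible)
    (hpos : 0 < S.ellMax) : S.hidingCost z.roundHidden ≤ S.ellMax * z.hidingObjective := by
  have hterm (b : A) : 0 ≤ S.ellMax * (S.cost b * z.x b) :=
    mul_nonneg (Nat.cast_nonneg _) (mul_nonneg (S.cost_nonneg b) (hz.x_mem b).1)
  rw [hidingCost, hidingObjective, Finset.mul_sum]
  refine (Finset.sum_le_sum fun b hb => ?_).trans
    (Finset.sum_le_univ_sum_of_nonneg (s := z.roundHidden) hterm)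
  rw [mul_left_comm]
  exact le_mul_of_one_le_right (S.cost_nonneg b) (one_le_ellMax_mul_x hpos hb)

variable [Fintype M] [DecidableEq M]

theorem Assignment.LPFeasible.isSolution_round {z : S.Assignment} (hz : z.LPFeasible) :
    S.IsSolution z.roundHidden z.roundPrivatized where
  private_req i :=
    (S.exists_reqSet_subset_iff i _).2 (hz.exists_reqSet_subset_roundHidden i)
  public_privatized i hi := by simpa [roundPrivatized] using hi

theorem Assignment.LPFeasible.privatizationCost_roundPrivatized_le {z : S.Assignment}
    (hz : z.LPFeasible) (hpos : 0 < S.ellMax) :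
    S.privatizationCost z.roundPrivatized ≤ S.ellMax * z.privatizationObjective := by
  have hterm (i : S.Public) : 0 ≤ S.ellMax * (S.pvt i * z.w i) :=
    mul_nonneg (Nat.cast_nonneg _) (mul_nonneg (S.pvt_nonneg i) (hz.w_mem i).1)
  rw [privatizationCost, privatizationObjective, Finset.mul_sum]
  refine (Finset.sum_le_sum fun i hi => ?_).trans
    (Finset.sum_le_univ_sum_of_nonneg (s := z.roundPrivatized) hterm)
  -- A hidden attribute of the module pays for its privatization, through `x b ≤ w i`.
  obtain ⟨b, hb, hbH⟩ := (Finset.mem_filter.1 hi).2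
  rw [mul_left_comm]
  exact le_mul_of_one_le_right (S.pvt_nonneg i) ((one_le_ellMax_mul_x hpos hbH).trans
    (mul_le_mul_of_nonneg_left (hz.x_le_w i b hb) (Nat.cast_nonneg _)))

theorem objective_indicatorAssignment (H : Finset A) (P : Finset S.Public) :
    (S.indicatorAssignment H P).objective = S.totalCost H P := by
  simp [Assignment.objective, Assignment.hidingObjective, Assignment.privatizationObjective,
    indicatorAssignment, totalCost, hidingCost, privatizationCost]

theorem Assignment.LPOptimal.isApproxSolution_round {z : S.Assignment} (hz : z.LPOptimal)
    (hpos : 0 < S.ellMax) :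
    S.IsApproxSolution S.ellMax z.roundHidden z.roundPrivatized := by
  refine ⟨hz.1.isSolution_round, fun H P h => ?_⟩
  calc S.totalCost z.roundHidden z.roundPrivatized
      ≤ S.ellMax * z.hidingObjective + S.ellMax * z.privatizationObjective :=
        add_le_add (hz.1.hidingCost_roundHidden_le hpos)
          (hz.1.privatizationCost_roundPrivatized_le hpos)
    _ = S.ellMax * z.objective := (mul_add _ _ _).symm
    _ ≤ S.ellMax * S.totalCost H P := by
        rw [← objective_indicatorAssignment]
        exact mul_le_mul_of_nonneg_left (hz.2 _ h.ipFeasible.lpFeasible) (Nat.cast_nonneg _)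

open Classical in
-- The supports of `x` and `w` form the solution; `r` is forgotten, as it does not enter the
-- objective. Taking the support of `w`, which may privatize more than necessary, makes the costs
-- agree exactly.
theorem Assignment.IPFeasible.exists_isSolution {z : S.Assignment} (hz : z.IPFeasible) :
    ∃ H P, S.IsSolution H P ∧ S.totalCost H P = z.objective := by
  refine ⟨Finset.univ.filter fun b => z.x b = 1, Finset.univ.filter fun i => z.w i = 1,
    ⟨fun i => (S.exists_reqSet_subset_iff i _).2 ?_, ?_⟩, ?_⟩
  · obtain ⟨j, -, hj⟩ : ∃ j ∈ Finset.univ, 0 < z.r i j :=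
      Finset.exists_lt_of_sum_lt (by simpa using zero_lt_one.trans_le (hz.sum_r i))
    refine ⟨j, fun b hb => ?_⟩
    have hx : z.x b ≠ 0 := (hj.trans_le (hz.r_le_x i j b hb)).ne'
    simpa using (hz.x_mem b).resolve_left hx
  · rintro i ⟨b, hb, hbH⟩
    have hx : z.x b = 1 := by simpa using hbH
    have hw : z.w i ≠ 0 := (zero_lt_one.trans_le (hx ▸ hz.x_le_w i b hb)).ne'
    simpa using (hz.w_mem i).resolve_left hw
  · simp only [totalCost, hidingCost, privatizationCost, objective, hidingObjective,
      privatizationObjective, Finset.sum_filter]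
    congr 1
    · refine Finset.sum_congr rfl fun b _ => ?_
      rcases hz.x_mem b with h | h <;> simp_all
    · refine Finset.sum_congr rfl fun i _ => ?_
      rcases hz.w_mem i with h | h <;> simp_all

variable (S) in
theorem ipFeasible_objective_eq_totalCost :
    {v : ℝ | ∃ z : S.Assignment, z.IPFeasible ∧ z.objective = v} =
      {v : ℝ | ∃ H P, S.IsSolution H P ∧ S.totalCost H P = v} := by
  ext v
  constructor
  · rintro ⟨z, hz, rfl⟩
    exact hz.exists_isSolution
  · rintro ⟨H, P, h, rfl⟩
    exact ⟨_, h.ipFeasible, objective_indicatorAssignment H P⟩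

variable (S) in
/-- The vectors `(x, r, w)` as a product space, which carries the product topology. -/
abbrev VariableSpace : Type _ :=
  (A → ℝ) × ((i : S.Private) → Fin (S.req i).length → ℝ) × (S.Public → ℝ)

/-- The feasible set of the relaxation is compact and non-empty, and the objective continuous. -/
theorem exists_lpOptimal (hreq : ∀ i, S.req i ≠ []) : ∃ z : S.Assignment, z.LPOptimal := by
  let toAssignment : S.VariableSpace → S.Assignment := fun p => ⟨p.1, p.2.1, p.2.2⟩
  let box : Set S.VariableSpace := (Set.univ.pi fun _ => Set.Icc 0 1) ×ˢ
    (Set.univ.pi fun _ => Set.univ.pi fun _ => Set.Icc 0 1) ×ˢ (Set.univ.pi fun _ => Set.Icc 0 1)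
  have hbox : IsCompact box :=
    (isCompact_univ_pi fun _ => isCompact_Icc).prod
      ((isCompact_univ_pi fun _ => isCompact_univ_pi fun _ => isCompact_Icc).prod
        (isCompact_univ_pi fun _ => isCompact_Icc))
  let constraints : Set S.VariableSpace := {p | (∀ i, 1 ≤ ∑ j, p.2.1 i j) ∧
    (∀ i j, ∀ b ∈ S.reqSet i j, p.2.1 i j ≤ p.1 b) ∧
    (∀ i : S.Public, ∀ b ∈ S.attrs i, p.1 b ≤ p.2.2 i)}
  have hconstraints : IsClosed constraints := by
    simp only [constraints, Set.ofPred_and, Set.ofPred_forall]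
    refine (isClosed_iInter fun i => ?_).inter ((isClosed_iInter fun i => isClosed_iInter fun j =>
      isClosed_iInter fun b => isClosed_iInter fun _ => ?_).inter
      (isClosed_iInter fun i => isClosed_iInter fun b => isClosed_iInter fun _ => ?_)) <;>
    exact isClosed_le (by fun_prop) (by fun_prop)
  have hmem (p : S.VariableSpace) : p ∈ box ∩ constraints ↔ (toAssignment p).LPFeasible := by
    constructor
    · rintro ⟨⟨hx, hr, hw⟩, h₁, h₂, h₃⟩
      exact ⟨⟨h₁, h₂, h₃⟩, fun b => hx b trivial, fun i j => hr i trivial j trivial,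
        fun i => hw i trivial⟩
    · rintro ⟨⟨h₁, h₂, h₃⟩, hx, hr, hw⟩
      exact ⟨⟨fun b _ => hx b, fun i _ j _ => hr i j, fun i _ => hw i⟩, h₁, h₂, h₃⟩
  have hne : (box ∩ constraints).Nonempty := by
    -- Hiding and privatizing everything is a solution because no requirement list is empty.
    let z := S.indicatorAssignment Finset.univ Finset.univ
    exact ⟨(z.x, z.r, z.w), (hmem _).2 (isSolution_univ hreq).ipFeasible.lpFeasible⟩
  have hcont : Continuous fun p => (toAssignment p).objective := by
    simp only [Assignment.objective, Assignment.hidingObjective,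
      Assignment.privatizationObjective, toAssignment]
    fun_prop
  obtain ⟨p, hp, hmin⟩ :=
    (hbox.inter_right hconstraints).exists_isMinOn hne hcont.continuousOn
  exact ⟨toAssignment p, (hmem p).1 hp, fun z hz => hmin ((hmem (z.x, z.r, z.w)).2 hz)⟩

end SecureView.Instance

theorem mainTheorem11 {A M : Type*} [Fintype A] [DecidableEq A] [Fintype M] [DecidableEq M]
    (S : SecureView.Instance A M) (hpriv : S.priv.Nonempty) (hreq : ∀ i, S.req i ≠ []) :
    -- the integer program has exactly the costs of the solutions as its objective values
    {v : ℝ | ∃ z : S.Assignment, z.IPFeasible ∧ z.objective = v} =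
        {v : ℝ | ∃ H P, S.IsSolution H P ∧ S.totalCost H P = v} ∧
    -- its LP relaxation has an optimal solution
    (∃ z : S.Assignment, z.LPOptimal) ∧
    -- rounding any LP solution gives a solution, and loses at most `ℓ_max` on either cost
    (∀ z : S.Assignment, z.LPFeasible →
      S.IsSolution z.roundHidden z.roundPrivatized ∧
      S.hidingCost z.roundHidden ≤ S.ellMax * z.hidingObjective ∧
      S.privatizationCost z.roundPrivatized ≤ S.ellMax * z.privatizationObjective) ∧
    -- rounding any optimal LP solution is an `ℓ_max`-approximation
    (∀ z : S.Assignment, z.LPOptimal →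
      S.IsApproxSolution S.ellMax z.roundHidden z.roundPrivatized) := by
  refine ⟨S.ipFeasible_objective_eq_totalCost, SecureView.Instance.exists_lpOptimal hreq,
    fun z hz => ⟨?_, ?_, ?_⟩, fun z hz => ?_⟩
  · exact hz.isSolution_round
  · exact hz.hidingCost_roundHidden_le (S.ellMax_pos hpriv hreq)
  · exact hz.privatizationCost_roundPrivatized_le (S.ellMax_pos hpriv hreq)
  · exact hz.isApproxSolution_round (S.ellMax_pos hpriv hreq)
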